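/- Let $\mathbb{K}$ be a field, let $\ell\ge 2$, and let $V=\mathbb{K}^\ell$ with coordinate ring $S=\mathbb{K}[x_1,\dots,x_\ell]$. Let $\mathcal{A}$ be a central arrangement in $V$, i.e. a finite set of linear hyperplanes $H=\ker\alpha_H$ with $0\ne\alpha_H\in V^*$, and let $$D(\mathcal{A})=\{\theta\in \mathrm{Der}_{\mathbb K}(S)\mid \theta(\alpha_H)\in S\alpha_H \text{ for all } H\in\mathcal{A}\}.$$ Say that $\mathcal{A}$ is free with $\exp(\mathcal{A})=(d_1,\dots,d_\ell)$ if $D(\mathcal{A})$ is a free $S$-module with a basis $\theta_1,\dots,\theta_\ell$ such that $\theta_i$ is homogeneous of degree $d_i$, that is, all coefficients $\theta_i(x_j)$ are homogeneous polynomials of degree $d_i$. Let $X$ be an intersection of hyperplanes of $\mathcal{A}$ with $\operatorname{codim}_V X=\ell-1$, and put $\mathcal{A}_X=\{H\in\mathcal{A}\mid X\subset H\}$. Suppose that $\mathcal{A}$ is free with $\exp(\mathcal{A})=(1,d_2,\dots,d_\ell)$, where $1\le d_2\le\cdots\le d_\ell$, and that $\mathcal{A}_X$ is free with $\exp(\mathcal{A}_X)=(0,1,e_2,\dots,e_{\ell-1})$,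 where $1\le e_2\le\cdots\le e_{\ell-1}$. Put $d_1=e_1=1$. Then $d_i\ge e_{i-1}$ for all $2\le i\le \ell$. Moreover, if $e_k>d_k$ for some $2\le k\le\ell-1$ (whatever the order relations between $d_i$ and $e_i$ for $i<k$), then $e_i=d_{i+1}$ for all $k\le i\le\ell-1$. -/

import Mathlib

/-- A central hyperplane arrangement in `V = K^ℓ`: a finite set of linear hyperplanes of `V`,
each of which is the kernel of a nonzero linear form. -/
structure CentralArrangement (K : Type*) [Field K] (ℓ : ℕ) where
  /-- the hyperplanes of the arrangement -/
  hyperplanes : Finset (Submodule K (Fin ℓ → K))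
  /-- every member is the zero set of a nonzero linear form -/
  exists_form : ∀ H ∈ hyperplanes,
    ∃ α : Module.Dual K (Fin ℓ → K), α ≠ 0 ∧ LinearMap.ker α = H

namespace CentralArrangement

variable {K : Type*} [Field K] {ℓ : ℕ}

/-- The linear form `α` viewed as a homogeneous linear polynomial in the coordinate ring
`S = K[x_1, …, x_ℓ]` of `V`. -/
noncomputable def linearPoly (α : Module.Dual K (Fin ℓ → K)) : MvPolynomial (Fin ℓ) K :=
  ∑ j, MvPolynomial.C (α (Pi.single j 1)) * MvPolynomial.X j

/-- The logarithmic derivation module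
`D(A) = {θ ∈ Der S | θ(α_H) ∈ S α_H for all H ∈ A}`.
The condition is imposed for every linear form `α` defining `H`; these differ only by nonzero
scalars, so it does not depend on the choice of `α_H`. -/
noncomputable def logDer (A : CentralArrangement K ℓ) :
    Submodule (MvPolynomial (Fin ℓ) K)
      (Derivation K (MvPolynomial (Fin ℓ) K) (MvPolynomial (Fin ℓ) K)) where
  carrier := {θ | ∀ H ∈ A.hyperplanes, ∀ α : Module.Dual K (Fin ℓ → K),
    LinearMap.ker α = H → linearPoly α ∣ θ (linearPoly α)}
  zero_mem' := fun _ _ _ _ => dvd_zero _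
  add_mem' := fun h₁ h₂ H hH α hα => dvd_add (h₁ H hH α hα) (h₂ H hH α hα)
  smul_mem' := fun f _ h H hH α hα => Dvd.dvd.mul_left (h H hH α hα) f

/-- A derivation `θ = ∑ θ(x_j) ∂_{x_j}` is homogeneous of (polynomial) degree `d` if all its
coefficients `θ(x_j)` are homogeneous polynomials of degree `d`. -/
def IsHomogeneousDer
    (θ : Derivation K (MvPolynomial (Fin ℓ) K) (MvPolynomial (Fin ℓ) K)) (d : ℕ) : Prop :=
  ∀ j, (θ (MvPolynomial.X j)).IsHomogeneous d

/-- `A` is free with `exp(A) = (d_1, …, d_ℓ)`: the `S`-module `D(A)` has a basis consisting of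
homogeneous derivations of degrees `d_1, …, d_ℓ`. -/
def IsFreeWithExp (A : CentralArrangement K ℓ) (d : Fin ℓ → ℕ) : Prop :=
  ∃ b : Module.Basis (Fin ℓ) (MvPolynomial (Fin ℓ) K) A.logDer,
    ∀ i, IsHomogeneousDer (b i).1 (d i)

/-- The intersection lattice `L(A)`: all intersections of subsets of `A`
(the empty intersection being `V`). -/
def intersectionLattice (A : CentralArrangement K ℓ) : Set (Submodule K (Fin ℓ → K)) :=
  {X | ∃ B : Finset (Submodule K (Fin ℓ → K)), B ⊆ A.hyperplanes ∧ X = B.inf id}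

/-- `L_k(A)`: the elements of the intersection lattice of codimension `k` in `V`. -/
def flatsOfCodim (A : CentralArrangement K ℓ) (k : ℕ) : Set (Submodule K (Fin ℓ → K)) :=
  {X | X ∈ A.intersectionLattice ∧ Module.finrank K X + k = ℓ}

open Classical in
/-- The localization `A_X = {H ∈ A | X ⊆ H}`. -/
noncomputable def localization (A : CentralArrangement K ℓ) (X : Submodule K (Fin ℓ → K)) :
    CentralArrangement K ℓ where
  hyperplanes := A.hyperplanes.filter (fun H => X ≤ H)
  exists_form := fun H hH => A.exists_form H (Finset.mem_filter.mp hH).1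

end CentralArrangement

/-!
Let `φ_0, …, φ_{ℓ-1}` and `θ_1, …, θ_ℓ` be homogeneous bases of `D(A_X)` and `D(A)`, of degrees
`e_j` and `d_i`. Since `D(A) ≤ D(A_X)`, one can write `θ_i = ∑ a_{ij} φ_j`. The entry `a_{ij}` is
homogeneous of degree `d_i - e_j`: it vanishes when `d_i < e_j`, and it has zero constant term
unless `d_i = e_j` (`repr_eq_zero_of_lt`, `eq_of_constantCoeff_repr_ne_zero`).

Let `Q'` be the product of the forms of the hyperplanes not containing `X`. Then
`Q' φ_j ∈ D(A)` for all `j`, so `det a` divides a power of `Q'` and is nonzero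
(`det_block_dvd_pow`). A nonzero term of its Leibniz expansion matches the `d_i` with the `e_j`
so that `d_i ≥ e_{σ i}`, and the first claim follows by sorting (`le_of_perm_le`).

If `e_k > d_k`, then `a` is block triangular, and the claim is that its lower right block `M` has
unit determinant: then some term of the Leibniz expansion of `det M(0)` is nonzero, which matches
the remaining `d_i` with the remaining `e_j` *exactly*, and together with the inequalities this
gives the equalities. Now `φ_0` has degree `0`, so it is a constant vector field; it spans the line
`X`. Hence `φ_0(α_H)` is a nonzero constant for each `H` not containing `X`, and subtracting a
multiple of `φ_0` from `φ_j` produces a derivation that kills `α_H`. Multiplied by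
`Q'_H = Q' / α_H` it lies in `D(A)`. The correction is invisible in the block `M`, as `0` is not
one of its indices, so `det M` divides a power of `Q'_H` for every `H`. The `Q'_H` have no
common prime factor, so `det M` is a unit (`isUnit_of_forall_dvd_prod_erase_pow`). If every
hyperplane contains `X`, then `Q' = 1` and `det M` divides `1` by `det_block_dvd_pow`.
-/

namespace CentralArrangement

open MvPolynomial

variable {K : Type*} [Field K] {ℓ : ℕ}

/-! ### Linear forms as polynomials -/

lemma eval_linearPoly (α : Module.Dual K (Fin ℓ → K)) (v : Fin ℓ → K) :
    eval v (linearPoly α) = α v := by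
  rw [LinearMap.pi_apply_eq_sum_univ α v]
  simp only [linearPoly, map_sum, map_mul, eval_C, eval_X, smul_eq_mul]
  refine Finset.sum_congr rfl fun j _ => ?_
  rw [mul_comm]
  congr 2
  ext i
  simp [Pi.single_apply, eq_comm]

lemma linearPoly_smul (c : K) (α : Module.Dual K (Fin ℓ → K)) :
    linearPoly (c • α) = C c * linearPoly α := by
  simp [linearPoly, Finset.mul_sum, mul_assoc]

lemma irreducible_linearPoly {α : Module.Dual K (Fin ℓ → K)} (hα : α ≠ 0) :
    Irreducible (linearPoly α) := by
  obtain ⟨j, hj⟩ : ∃ j, α (Pi.single j 1) ≠ 0 := by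
    by_contra! h
    exact hα (LinearMap.pi_ext' fun i => LinearMap.ext_ring (by simpa using h i))
  let c : Fin ℓ →₀ K := Finsupp.equivFunOnFinite.symm fun i => α (Pi.single i 1)
  have hc : linearPoly α = sumSMulX c := by
    rw [sumSMulX, Finsupp.linearCombination_apply, Finsupp.sum_fintype _ _ (by simp)]
    simp [linearPoly, c, smul_eq_C_mul]
  rw [hc]
  refine irreducible_sumSMulX c ⟨j, Finsupp.mem_support_iff.mpr hj⟩ fun r hr => ?_
  exact isUnit_of_dvd_unit (hr j) (IsUnit.mk0 _ hj)

lemma ker_le_ker_of_linearPoly_dvd {α β : Module.Dual K (Fin ℓ → K)}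
    (h : linearPoly α ∣ linearPoly β) : LinearMap.ker α ≤ LinearMap.ker β := by
  intro v hv
  obtain ⟨q, hq⟩ := h
  rw [LinearMap.mem_ker] at hv ⊢
  rw [← eval_linearPoly β, hq, map_mul, eval_linearPoly, hv, zero_mul]

lemma ker_eq_ker_of_ker_le_ker {α β : Module.Dual K (Fin ℓ → K)} (hβ : β ≠ 0)
    (h : LinearMap.ker α ≤ LinearMap.ker β) : LinearMap.ker α = LinearMap.ker β := by
  have hmem := mem_span_of_iInf_ker_le_ker (L := fun _ : Unit => α) (K := β) (by simpa using h)
  rw [Set.range_const, Submodule.mem_span_singleton] at hmem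
  obtain ⟨c, rfl⟩ := hmem
  have hc : c ≠ 0 := by rintro rfl; simp at hβ
  rw [LinearMap.ker_smul _ _ hc]

/-- Membership in `D(A)` may be tested on one defining form for each hyperplane. -/
lemma mem_logDer_of_forms {A : CentralArrangement K ℓ}
    {f : Submodule K (Fin ℓ → K) → Module.Dual K (Fin ℓ → K)}
    (hf : ∀ H ∈ A.hyperplanes, LinearMap.ker (f H) = H)
    {θ : Derivation K (MvPolynomial (Fin ℓ) K) (MvPolynomial (Fin ℓ) K)}
    (hθ : ∀ H ∈ A.hyperplanes, linearPoly (f H) ∣ θ (linearPoly (f H))) : θ ∈ A.logDer := by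
  intro H hH α hα
  have hle : LinearMap.ker (f H) ≤ LinearMap.ker α := by rw [hf H hH, hα]
  have hmem := mem_span_of_iInf_ker_le_ker (L := fun _ : Unit => f H) (K := α) (by simpa using hle)
  rw [Set.range_const, Submodule.mem_span_singleton] at hmem
  obtain ⟨c, rfl⟩ := hmem
  rw [linearPoly_smul, ← smul_eq_C_mul, Derivation.map_smul, smul_eq_C_mul, smul_eq_C_mul]
  exact mul_dvd_mul_left _ (hθ H hH)

/-- A derivation of degree `0` is differentiation in the direction of a constant vector. -/
lemma exists_apply_linearPoly_of_isHomogeneousDer_zero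
    {θ : Derivation K (MvPolynomial (Fin ℓ) K) (MvPolynomial (Fin ℓ) K)}
    (hθ : IsHomogeneousDer θ 0) (h0 : θ ≠ 0) :
    ∃ v : Fin ℓ → K, v ≠ 0 ∧
      ∀ α : Module.Dual K (Fin ℓ → K), θ (linearPoly α) = C (α v) := by
  have hX : ∀ j, θ (X j) = C (coeff 0 (θ (X j))) := fun j =>
    totalDegree_eq_zero_iff_eq_C.mp (Nat.le_zero.mp (hθ j).totalDegree_le)
  refine ⟨fun j => coeff 0 (θ (X j)), fun hv => h0 ?_, fun α => ?_⟩
  · refine derivation_ext fun j => ?_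
    rw [hX j, congrFun hv j]
    simp
  · rw [← eval_linearPoly α]
    simp only [linearPoly, map_sum, map_mul, eval_C, eval_X, Derivation.leibniz,
      derivation_C, add_zero, smul_eq_mul, mul_zero]
    exact Finset.sum_congr rfl fun j _ => by rw [hX j]; simp

/-! ### The transition matrix between nested free modules -/

/-- Let `D ≤ E` be free with bases `b`, `c`. If the rows outside `p` of the transition matrix vanish
in the columns in `p`, and `D` contains, modulo the `c j` with `j` outside `p`, the
multiple `g • c j` for every `j` in `p`, then the determinant of the `p`-block divides a power of
`g`. -/
lemma det_block_dvd_pow {R M ι : Type*} [CommRing R] [AddCommGroup M] [Module R M] [Fintype ι]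
    [DecidableEq ι] {D E : Submodule R M} (hDE : D ≤ E) (b : Module.Basis ι R D)
    (c : Module.Basis ι R E) (p : ι → Prop) [DecidablePred p]
    (hblock : ∀ i j, ¬ p i → p j → c.repr (Submodule.inclusion hDE (b i)) j = 0) (g : R)
    (hg : ∀ j, p j → ∃ ψ : D, ∀ j', p j' →
      c.repr (Submodule.inclusion hDE ψ) j' = if j' = j then g else 0) :
    ((Matrix.of fun i j => c.repr (Submodule.inclusion hDE (b i)) j).toSquareBlockProp p).det ∣
      g ^ Fintype.card {i // p i} := by
  choose ψ hψ using hg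
  let B : Matrix {i // p i} {i // p i} R := Matrix.of fun j i => b.repr (ψ j j.2) i
  have hmul : B * (Matrix.of fun i j =>
      c.repr (Submodule.inclusion hDE (b i)) j).toSquareBlockProp p = g • 1 := by
    ext j j'
    have key : c.repr (Submodule.inclusion hDE (ψ j j.2)) j' =
        ∑ i, b.repr (ψ j j.2) i * c.repr (Submodule.inclusion hDE (b i)) j' := by
      conv_lhs => rw [← b.sum_repr (ψ j j.2)]
      simp only [map_sum, map_smul, Finsupp.finsetSum_apply, Finsupp.smul_apply, smul_eq_mul]
    rw [hψ j j.2 j' j'.2] at key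
    have hsum : ∑ i, b.repr (ψ j j.2) i * c.repr (Submodule.inclusion hDE (b i)) j' =
        ∑ i : {i // p i}, b.repr (ψ j j.2) i * c.repr (Submodule.inclusion hDE (b i)) j' := by
      rw [← Finset.sum_subtype (Finset.univ.filter p) (by simp)
        fun i => b.repr (ψ j j.2) i * c.repr (Submodule.inclusion hDE (b i)) j', Finset.sum_filter]
      refine Finset.sum_congr rfl fun i _ => ?_
      split_ifs with hi
      · rfl
      · rw [hblock i j' hi j'.2, mul_zero]
    simp only [Matrix.mul_apply, Matrix.toSquareBlockProp_def, Matrix.of_apply, B,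
      Matrix.smul_apply, Matrix.one_apply, smul_eq_mul, mul_ite, mul_one, mul_zero]
    rw [← hsum, ← key]
    simp [Subtype.ext_iff, eq_comm]
  refine ⟨B.det, ?_⟩
  rw [mul_comm, ← Matrix.det_mul, hmul, Matrix.det_smul, Matrix.det_one, mul_one]

lemma exists_perm_forall_ne_zero_of_det_ne_zero {R ι : Type*} [CommRing R] [Fintype ι]
    [DecidableEq ι] {M : Matrix ι ι R} (h : M.det ≠ 0) :
    ∃ σ : Equiv.Perm ι, ∀ i, M (σ i) i ≠ 0 := by
  rw [Matrix.det_apply] at h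
  obtain ⟨σ, -, hσ⟩ := Finset.exists_ne_zero_of_sum_ne_zero h
  refine ⟨σ, fun i hi => hσ ?_⟩
  rw [Finset.prod_eq_zero (f := fun i => M (σ i) i) (Finset.mem_univ i) hi, smul_zero]

/-- A bijection that dominates one monotone sequence by another forces pointwise domination. -/
lemma le_of_perm_le {n : ℕ} {e d : Fin n → ℕ} (he : Monotone e) (hd : Monotone d)
    (σ : Equiv.Perm (Fin n)) (h : ∀ i, e i ≤ d (σ i)) (i : Fin n) : e i ≤ d i := by
  -- Otherwise `σ` would embed the indices `≥ i` into the indices `> i`.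
  by_contra! hlt
  have hmaps : ∀ j ∈ Finset.Ici i, σ j ∈ Finset.Ioi i := by
    intro j hj
    rw [Finset.mem_Ici] at hj
    rw [Finset.mem_Ioi]
    by_contra! hle
    exact absurd ((he hj).trans ((h j).trans (hd hle))) (not_le.mpr hlt)
  have hcard := Finset.card_le_card_of_injOn σ hmaps σ.injective.injOn
  rw [Fin.card_Ici, Fin.card_Ioi] at hcard
  have := i.2
  omega

/-! ### Homogeneity of the transition coefficients -/

attribute [local instance] MvPolynomial.gradedAlgebra

lemma derivation_sum_apply {R S M ι : Type*} [CommSemiring R] [CommSemiring S] [AddCommMonoid M]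
    [Algebra R S] [Module S M] [Module R M] (s : Finset ι) (D : ι → Derivation R S M) (a : S) :
    (∑ i ∈ s, D i) a = ∑ i ∈ s, D i a := by
  have h := map_sum (Derivation.coeFnAddMonoidHom (R := R) (A := S) (M := M)) D s
  exact (congrFun h a).trans (Finset.sum_apply a s _)

/-- The coordinates of a homogeneous derivation of degree `m` in a homogeneous basis are
homogeneous of complementary degree; in particular they vanish in negative degree. -/
lemma repr_eq_homogeneousComponent {ι : Type*} [Fintype ι]
    {E : Submodule (MvPolynomial (Fin ℓ) K)
      (Derivation K (MvPolynomial (Fin ℓ) K) (MvPolynomial (Fin ℓ) K))}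
    (c : Module.Basis ι (MvPolynomial (Fin ℓ) K) E) {e : ι → ℕ}
    (hc : ∀ j, IsHomogeneousDer (c j).1 (e j)) {θ : E} {m : ℕ} (hθ : IsHomogeneousDer θ.1 m)
    (j : ι) :
    c.repr θ j = if e j ≤ m then homogeneousComponent (m - e j) (c.repr θ j) else 0 := by
  have hdec : ∀ (q : MvPolynomial (Fin ℓ) K) (n : ℕ),
      (DirectSum.decompose (homogeneousSubmodule (Fin ℓ) K) q n : MvPolynomial (Fin ℓ) K) =
        homogeneousComponent n q := fun q n => decomposition.decompose'_apply q n
  have hsum : θ = ∑ i, (if e i ≤ m then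
      homogeneousComponent (m - e i) (c.repr θ i) else 0) • c i := by
    apply Subtype.ext
    refine derivation_ext fun x => ?_
    have h1 : θ.1 (X x) = ∑ i, c.repr θ i * (c i).1 (X x) := by
      conv_lhs => rw [← c.sum_repr θ]
      simp only [AddSubmonoidClass.coe_finsetSum, Submodule.coe_smul, derivation_sum_apply,
        Derivation.smul_apply, smul_eq_mul]
    have h2 : θ.1 (X x) = homogeneousComponent m (θ.1 (X x)) := by
      rw [homogeneousComponent_of_mem (hθ x), if_pos rfl]
    rw [h2, h1, map_sum]
    simp only [AddSubmonoidClass.coe_finsetSum, Submodule.coe_smul, derivation_sum_apply,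
      Derivation.smul_apply, smul_eq_mul]
    refine Finset.sum_congr rfl fun i _ => ?_
    rw [← hdec, DirectSum.coe_decompose_mul_of_right_mem (homogeneousSubmodule (Fin ℓ) K) m
      (hc i x), hdec]
    split_ifs <;> simp
  have hrepr := congrArg (fun z => c.repr z j) hsum
  simpa only [c.repr_sum_self] using hrepr


lemma repr_eq_zero_of_lt {ι : Type*} [Fintype ι]
    {E : Submodule (MvPolynomial (Fin ℓ) K)
      (Derivation K (MvPolynomial (Fin ℓ) K) (MvPolynomial (Fin ℓ) K))}
    (c : Module.Basis ι (MvPolynomial (Fin ℓ) K) E) {e : ι → ℕ}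
    (hc : ∀ j, IsHomogeneousDer (c j).1 (e j)) {θ : E} {m : ℕ} (hθ : IsHomogeneousDer θ.1 m)
    {j : ι} (h : m < e j) : c.repr θ j = 0 := by
  rw [repr_eq_homogeneousComponent c hc hθ, if_neg (not_le.mpr h)]

lemma eq_of_constantCoeff_repr_ne_zero {ι : Type*} [Fintype ι]
    {E : Submodule (MvPolynomial (Fin ℓ) K)
      (Derivation K (MvPolynomial (Fin ℓ) K) (MvPolynomial (Fin ℓ) K))}
    (c : Module.Basis ι (MvPolynomial (Fin ℓ) K) E) {e : ι → ℕ}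
    (hc : ∀ j, IsHomogeneousDer (c j).1 (e j)) {θ : E} {m : ℕ} (hθ : IsHomogeneousDer θ.1 m)
    {j : ι} (h : constantCoeff (c.repr θ j) ≠ 0) : e j = m := by
  rw [repr_eq_homogeneousComponent c hc hθ] at h
  split_ifs at h with hle
  · by_contra hne
    refine h ((homogeneousComponent_isHomogeneous (m - e j) (c.repr θ j)).coeff_eq_zero ?_)
    simp only [map_zero]
    omega
  · simp at h

/-! ### Coprimality of the partial products -/

/-- If pairwise nonassociated irreducibles are multiplied together with one of them left out, the
products obtained have no common prime factor. -/
lemma isUnit_of_forall_dvd_prod_erase_pow {R ι : Type*} [CommRing R] [IsDomain R]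
    [UniqueFactorizationMonoid R] [DecidableEq ι] {s : Finset ι} (hs : s.Nonempty) {f : ι → R}
    (hirr : ∀ i ∈ s, Irreducible (f i)) (hdvd : ∀ i ∈ s, ∀ j ∈ s, f i ∣ f j → i = j)
    {δ : R} {n : ℕ} (h : ∀ i ∈ s, δ ∣ (∏ j ∈ s.erase i, f j) ^ n) : IsUnit δ := by
  by_contra hδ
  have hδ0 : δ ≠ 0 := by
    obtain ⟨i, hi⟩ := hs
    refine ne_zero_of_dvd_ne_zero (pow_ne_zero _ (Finset.prod_ne_zero_iff.mpr fun j hj => ?_))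
      (h i hi)
    exact (hirr j (Finset.mem_of_mem_erase hj)).ne_zero
  obtain ⟨p, hp, hpδ⟩ := WfDvdMonoid.exists_irreducible_factor hδ hδ0
  have hfac : ∀ i ∈ s, ∃ j ∈ s.erase i, p ∣ f j := fun i hi =>
    (hp.prime.dvd_finsetProd_iff f).mp (hp.prime.dvd_of_dvd_pow (hpδ.trans (h i hi)))
  obtain ⟨i, hi⟩ := hs
  obtain ⟨j, hj, hpj⟩ := hfac i hi
  have hjs := Finset.mem_of_mem_erase hj
  obtain ⟨k, hk, hpk⟩ := hfac j hjs
  have hjk : f j ∣ f k := ((hp.associated_of_dvd (hirr j hjs) hpj).symm.dvd).trans hpk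
  exact Finset.ne_of_mem_erase hk (hdvd j hjs k (Finset.mem_of_mem_erase hk) hjk).symm

/-! ### Localization at a line -/

lemma logDer_le_logDer_localization (A : CentralArrangement K ℓ) (X : Submodule K (Fin ℓ → K)) :
    A.logDer ≤ (A.localization X).logDer :=
  fun _ hθ H hH => hθ H (by classical exact (Finset.mem_filter.mp hH).1)

/-- A constant vector field in `D(A_X)` points along `X`. -/
lemma mem_of_forall_localization_apply_eq_zero {A : CentralArrangement K ℓ}
    {X : Submodule K (Fin ℓ → K)} (hX : X ∈ A.intersectionLattice)
    {θ : Derivation K (MvPolynomial (Fin ℓ) K) (MvPolynomial (Fin ℓ) K)}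
    (hθ : θ ∈ (A.localization X).logDer) {v : Fin ℓ → K}
    (hv : ∀ α : Module.Dual K (Fin ℓ → K), θ (linearPoly α) = C (α v)) : v ∈ X := by
  classical
  obtain ⟨B, hB, rfl⟩ := hX
  rw [Submodule.mem_finsetInf]
  intro H hH
  obtain ⟨α, hα0, hα⟩ := A.exists_form H (hB hH)
  have hdvd := hθ H (Finset.mem_filter.mpr ⟨hB hH, Finset.inf_le (f := id) hH⟩) α hα
  rw [hv] at hdvd
  by_contra hvH
  have hne : α v ≠ 0 := fun h0 => hvH (by rw [id, ← hα]; exact h0)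
  exact (irreducible_linearPoly hα0).not_isUnit
    (isUnit_of_dvd_unit hdvd ((IsUnit.mk0 _ hne).map C))

lemma le_of_mem_of_finrank_eq_one {X H : Submodule K (Fin ℓ → K)} (hX : Module.finrank K X = 1)
    {v : Fin ℓ → K} (hv0 : v ≠ 0) (hvX : v ∈ X) (hvH : v ∈ H) : X ≤ H := by
  intro w hw
  obtain ⟨c, hc⟩ := (finrank_eq_one_iff_of_nonzero' (⟨v, hvX⟩ : X) (by simpa using hv0)).mp hX
    ⟨w, hw⟩
  have hcw : c • v = w := congrArg Subtype.val hc
  exact hcw ▸ H.smul_mem c hvH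

end CentralArrangement

open MvPolynomial CentralArrangement

/-- The exponents of `A` are `(d 1, d 2, …, d ℓ)` with `d 1 = 1`, and those of `A_X` are
`(e 0, e 1, e 2, …, e (ℓ - 1))` with `e 0 = 0` and `e 1 = 1`, both in nondecreasing order.
Only these values of `d` and `e` are used. -/
theorem theorem5p6 {K : Type*} [Field K] (ℓ : ℕ) (hℓ : 2 ≤ ℓ)
    (A : CentralArrangement K ℓ) (d : ℕ → ℕ)
    (hd_one : d 1 = 1)
    (hd_mono : ∀ i j, 1 ≤ i → i ≤ j → j ≤ ℓ → d i ≤ d j)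
    (hA : A.IsFreeWithExp (fun i : Fin ℓ => d ((i : ℕ) + 1)))
    (X : Submodule K (Fin ℓ → K)) (hX : X ∈ A.flatsOfCodim (ℓ - 1))
    (e : ℕ → ℕ) (he_zero : e 0 = 0) (he_one : e 1 = 1)
    (he_mono : ∀ i j, i ≤ j → j ≤ ℓ - 1 → e i ≤ e j)
    (hAX : (A.localization X).IsFreeWithExp (fun i : Fin ℓ => e (i : ℕ))) :
    (∀ i, 2 ≤ i → i ≤ ℓ → e (i - 1) ≤ d i) ∧
      (∀ k, 2 ≤ k → k ≤ ℓ - 1 → d k < e k →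
        ∀ i, k ≤ i → i ≤ ℓ - 1 → e i = d (i + 1)) := by
  classical
  obtain ⟨b, hb⟩ := hA
  obtain ⟨c, hc⟩ := hAX
  have hDE := A.logDer_le_logDer_localization X
  have hX1 : Module.finrank K X = 1 := by have := hX.2; omega
  have hforms : ∀ H, ∃ α : Module.Dual K (Fin ℓ → K), H ∈ A.hyperplanes →
      α ≠ 0 ∧ LinearMap.ker α = H := fun H => by
    by_cases hH : H ∈ A.hyperplanes
    · exact (A.exists_form H hH).imp fun _ h _ => h
    · exact ⟨0, fun h => absurd h hH⟩
  choose f hf using hforms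
  let off := A.hyperplanes.filter fun H => ¬ X ≤ H
  have hoff : ∀ H ∈ off, H ∈ A.hyperplanes ∧ ¬ X ≤ H := fun H hH => Finset.mem_filter.mp hH
  have hirr : ∀ H ∈ off, Irreducible (linearPoly (f H)) := fun H hH =>
    irreducible_linearPoly (hf H (hoff H hH).1).1
  -- A derivation in `D(A_X)` that is compatible with the forms off `X` lies in `D(A)`.
  have hmem : ∀ ψ ∈ (A.localization X).logDer,
      (∀ H ∈ off, linearPoly (f H) ∣ ψ (linearPoly (f H))) → ψ ∈ A.logDer := by
    intro ψ hψ h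
    refine mem_logDer_of_forms (fun H hH => (hf H hH).2) fun H hH => ?_
    by_cases hXH : X ≤ H
    · exact hψ H (Finset.mem_filter.mpr ⟨hH, hXH⟩) _ (hf H hH).2
    · exact h H (Finset.mem_filter.mpr ⟨hH, hXH⟩)
  have hbE : ∀ i, IsHomogeneousDer (Submodule.inclusion hDE (b i)).1 (d ((i : ℕ) + 1)) := hb
  have hprod : ∀ j, ∃ ψ : A.logDer, Submodule.inclusion hDE ψ =
      (∏ H ∈ off, linearPoly (f H)) • c j := fun j =>
    ⟨⟨_, hmem ((∏ H ∈ off, linearPoly (f H)) • c j : (A.localization X).logDer).1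
      (Subtype.property _) fun H hH =>
        Dvd.dvd.mul_right (Finset.dvd_prod_of_mem (fun H => linearPoly (f H)) hH) _⟩, rfl⟩
  have hle : ∀ i : Fin ℓ, e i ≤ d ((i : ℕ) + 1) := by
    have hdvd := det_block_dvd_pow hDE b c (fun _ => True) (fun _ _ h => absurd trivial h)
      (∏ H ∈ off, linearPoly (f H)) fun j _ => by
        obtain ⟨ψ, hψ⟩ := hprod j
        exact ⟨ψ, fun j' _ => by simp [hψ, Finsupp.single_apply, eq_comm]⟩
    have hne := ne_zero_of_dvd_ne_zero
      (pow_ne_zero _ (Finset.prod_ne_zero_iff.mpr fun H hH => (hirr H hH).ne_zero)) hdvd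
    obtain ⟨σ, hσ⟩ := exists_perm_forall_ne_zero_of_det_ne_zero hne
    let τ : Equiv.Perm (Fin ℓ) := (Equiv.Set.univ (Fin ℓ)).permCongr σ
    refine le_of_perm_le (e := fun i : Fin ℓ => e i) (d := fun i : Fin ℓ => d ((i : ℕ) + 1))
      (fun i j hij => he_mono _ _ hij (by omega))
      (fun i j hij => hd_mono _ _ (by omega) (Nat.succ_le_succ hij) (by omega)) τ fun i => ?_
    by_contra! hlt
    exact hσ ⟨i, trivial⟩ (repr_eq_zero_of_lt c hc (hbE _) hlt)
  refine ⟨fun i hi hiℓ => ?_, fun k hk hkℓ hdk i hki hiℓ => ?_⟩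
  · have := hle ⟨i - 1, by omega⟩
    rwa [Fin.val_mk, Nat.sub_add_cancel (by omega)] at this
  let p : Fin ℓ → Prop := fun j => k ≤ j
  have hblock : ∀ i j, ¬ p i → p j → c.repr (Submodule.inclusion hDE (b i)) j = 0 := by
    intro i j hi hj
    refine repr_eq_zero_of_lt c hc (hbE i) ?_
    calc d ((i : ℕ) + 1) ≤ d k := hd_mono _ _ (by omega) (by simp only [p] at hi; omega) (by omega)
      _ < e k := hdk
      _ ≤ e j := he_mono _ _ hj (by omega)
  let i₀ : Fin ℓ := ⟨0, by omega⟩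
  have hi₀ : ∀ j, p j → j ≠ i₀ := by
    rintro j hj rfl
    simp only [p, i₀] at hj
    omega
  obtain ⟨v, hv0, hv⟩ := exists_apply_linearPoly_of_isHomogeneousDer_zero
    (θ := (c i₀).1) (he_zero ▸ hc i₀) (fun h => c.ne_zero i₀ (Subtype.ext h))
  have hvX := mem_of_forall_localization_apply_eq_zero hX.1 (c i₀).2 hv
  have hunit : IsUnit ((Matrix.of fun i j =>
      c.repr (Submodule.inclusion hDE (b i)) j).toSquareBlockProp p).det := by
    rcases off.eq_empty_or_nonempty with hempty | hne
    · refine isUnit_of_dvd_one ?_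
      simpa using det_block_dvd_pow hDE b c p hblock 1 fun j _ => by
        obtain ⟨ψ, hψ⟩ := hprod j
        exact ⟨ψ, fun j' _ => by simp [hψ, hempty, Finsupp.single_apply, eq_comm]⟩
    refine isUnit_of_forall_dvd_prod_erase_pow hne hirr (fun H hH H' hH' h => ?_) fun H hH =>
      det_block_dvd_pow hDE b c p hblock _ fun j hj => ?_
    · have h1 := hf H (hoff H hH).1
      have h2 := hf H' (hoff H' hH').1
      rw [← h1.2, ← h2.2]
      exact ker_eq_ker_of_ker_le_ker h2.1 (ker_le_ker_of_linearPoly_dvd h)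
    · have hfH := hf H (hoff H hH).1
      have hfv : f H v ≠ 0 := fun h => (hoff H hH).2
        (le_of_mem_of_finrank_eq_one hX1 hv0 hvX (by rw [← hfH.2]; exact h))
      -- `ψ` kills the form of `H`, since `c i₀` takes the constant value `f H v` on it.
      let ψ : (A.localization X).logDer := (∏ H' ∈ off.erase H, linearPoly (f H')) •
        (c j + -(C (f H v)⁻¹ * (c j).1 (linearPoly (f H))) • c i₀)
      have hψ : ψ.1 ∈ A.logDer := by
        refine hmem _ ψ.2 fun H' hH' => ?_
        by_cases hHH : H' = H
        · have hzero : ψ.1 (linearPoly (f H)) = 0 := by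
            have hC : (C (f H v)⁻¹ : MvPolynomial (Fin ℓ) K) * C (f H v) = 1 := by
              rw [← C_mul, inv_mul_cancel₀ hfv, C_1]
            simp only [ψ, Submodule.coe_smul, Submodule.coe_add, Derivation.smul_apply,
              Derivation.add_apply, smul_eq_mul, hv]
            linear_combination (-(∏ H' ∈ off.erase H, linearPoly (f H')) *
              (c j).1 (linearPoly (f H))) * hC
          rw [hHH, hzero]
          exact dvd_zero _
        · exact Dvd.dvd.mul_right (Finset.dvd_prod_of_mem (fun H => linearPoly (f H))
            (Finset.mem_erase.mpr ⟨hHH, hH'⟩)) _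
      refine ⟨⟨ψ.1, hψ⟩, fun j' hj' => ?_⟩
      have hincl : Submodule.inclusion hDE ⟨ψ.1, hψ⟩ = ψ := rfl
      rw [hincl]
      simp only [ψ, map_smul, map_add, Module.Basis.repr_self, Finsupp.smul_apply,
        Finsupp.add_apply, Finsupp.single_apply, if_neg (hi₀ j' hj'), smul_eq_mul, mul_zero, add_zero,
        mul_ite, mul_one, eq_comm]
  -- Setting all variables to `0` keeps the determinant nonzero and only the entries of degree `0`.
  have hdet0 := (hunit.map (constantCoeff (σ := Fin ℓ) (R := K))).ne_zero
  rw [RingHom.map_det] at hdet0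
  obtain ⟨σ, hσ⟩ := exists_perm_forall_ne_zero_of_det_ne_zero hdet0
  have hdeg : ∀ j : {j // p j}, e (j : Fin ℓ) = d ((σ j : Fin ℓ) + 1) := fun j =>
    eq_of_constantCoeff_repr_ne_zero c hc (hbE _) (hσ j)
  have hsum : ∑ j : {j // p j}, e (j : Fin ℓ) = ∑ j : {j // p j}, d ((j : Fin ℓ) + 1) := by
    rw [← Equiv.sum_comp σ fun j : {j // p j} => d ((j : Fin ℓ) + 1)]
    exact Finset.sum_congr rfl fun j _ => hdeg j
  exact (Finset.sum_eq_sum_iff_of_le fun (j : {j // p j}) _ => hle j).mp hsum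
    ⟨⟨i, by omega⟩, hki⟩ (Finset.mem_univ _)
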